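/- Let $n\ge 2$ and let $\mathcal P_n$ be the partition monoid of degree $n$: its elements are the set partitions of $[n]\cup[n]'$, where $[n]=\{1,\dots,n\}$ and $[n]'=\{1',\dots,n'\}$ is a disjoint copy. The product $ab$ is obtained by identifying the lower row of $a$ with the upper row of $b$; two elements of $[n]\cup[n]'$ lie in the same block of $ab$ if and only if they are in the same connected component of the resulting graph on three rows. The involution $a\mapsto a^*$ interchanges $i$ and $i'$ for all $i$. The rank of $a$ is the number of blocks that meet both $[n]$ and $[n]'$. A projection is an element $p$ with $p^2=p=p^*$; let $P=\mathsf P(\mathcal P_n)$ be the set of projections, with the operations $q\mapsto pqp$ ($p\in P$). Let $\mathsf{PG}(P)$ be the semigroup defined by the presentation \[ \bigl\langle x_p\ (p\in P)\ \big|\ x_p^2=x_p,\ (x_px_q)^2=x_px_q,\ x_px_qx_p=x_{pqp}\ (p,q\in P)\bigr\rangle , \] the free projection-generated regular $*$-semigroup over $P$, and let $\pi\colon\mathsf{PG}(P)\to\mathcal P_n$ be the homomorphism with $x_p\mapsto p$. The maximal subgroup of a semigroup containing an idempotent $e$ is the $\mathscr H$-class of $e$. Let $0\le r\le n-2$. Then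 for every projection $p\in P$ of rank $r$ the maximal subgroup of $\mathsf{PG}(P)$ containing $x_p$ is isomorphic to the symmetric group $S_r$. More generally, for every idempotent $e\in\mathcal P_n$ of rank $r$ there is exactly one idempotent $f$ of $\mathsf{PG}(P)$ with $\pi(f)=e$, and the maximal subgroup of $\mathsf{PG}(P)$ containing this $f$ is isomorphic to $S_r$. -/

import Mathlib

/-! ### Regular `*`-semigroups and their projections -/

/-- A regular `*`-semigroup: `a** = a = a a* a` and `(ab)* = b* a*`. -/
class RegularStarSemigroup (S : Type*) [Semigroup S] extends StarMul S where
  mul_star_mul_self : ∀ a : S, a * star a * a = a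

/-- The set `P(S)` of projections of `S`, i.e. of the idempotents `p` with `p* = p`. -/
abbrev Projections (S : Type*) [Semigroup S] [RegularStarSemigroup S] : Type _ :=
  {p : S // IsStarProjection p}

namespace Projections

variable {S : Type*} [Semigroup S] [RegularStarSemigroup S]

theorem mul_mul_mul (p q : Projections S) : (p * q * (p * q) : S) = p * q := by
  have h := RegularStarSemigroup.mul_star_mul_self (p * q : S)
  rw [star_mul, p.2.isSelfAdjoint.star_eq, q.2.isSelfAdjoint.star_eq] at h
  calc (p * q * (p * q) : S) = p * (q * q) * (p * p) * q := by
        rw [q.2.isIdempotentElem.eq, p.2.isIdempotentElem.eq]; simp only [mul_assoc]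
    _ = p * q * (q * p) * (p * q) := by simp only [mul_assoc]
    _ = p * q := h

/-- The projection algebra operations `θ_p : q ↦ pqp`. -/
def theta (p q : Projections S) : Projections S :=
  ⟨p * q * p, by
    constructor
    · change (p * q * p * (p * q * p) : S) = p * q * p
      calc (p * q * p * (p * q * p) : S) = p * q * (p * p) * q * p := by simp only [mul_assoc]
        _ = (p * q * (p * q)) * p := by rw [p.2.isIdempotentElem.eq]; simp only [mul_assoc]
        _ = p * q * p := by rw [mul_mul_mul]
    · change star (p * q * p : S) = p * q * p
      rw [star_mul, star_mul, p.2.isSelfAdjoint.star_eq, q.2.isSelfAdjoint.star_eq, mul_assoc]⟩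

end Projections

/-! ### The free projection-generated regular `*`-semigroup -/

/-- The defining relations `x_p² = x_p`, `(x_p x_q)² = x_p x_q`, `x_p x_q x_p = x_{pqp}`. -/
inductive PGRel (S : Type*) [Semigroup S] [RegularStarSemigroup S] :
    FreeSemigroup (Projections S) → FreeSemigroup (Projections S) → Prop
  | idem (p : Projections S) :
      PGRel S (FreeSemigroup.of p * FreeSemigroup.of p) (FreeSemigroup.of p)
  | mul_idem (p q : Projections S) :
      PGRel S ((FreeSemigroup.of p * FreeSemigroup.of q) * (FreeSemigroup.of p * FreeSemigroup.of q))
        (FreeSemigroup.of p * FreeSemigroup.of q)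
  | theta (p q : Projections S) :
      PGRel S (FreeSemigroup.of p * FreeSemigroup.of q * FreeSemigroup.of p)
        (FreeSemigroup.of (p.theta q))

/-- `PG(P(S))`: the semigroup presented by the generators `x_p` (`p ∈ P(S)`) and the relations
`PGRel`. It depends only on the projection algebra `(P(S), θ)`. -/
abbrev PG (S : Type*) [Semigroup S] [RegularStarSemigroup S] : Type _ :=
  (conGen (PGRel S)).Quotient

namespace PG

variable {S : Type*} [Semigroup S] [RegularStarSemigroup S]

/-- The generator `x_p`. -/
def x (p : Projections S) : PG S := ((FreeSemigroup.of p : FreeSemigroup (Projections S)) : PG S)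

theorem isIdempotentElem_x (p : Projections S) : IsIdempotentElem (x p) :=
  (Con.eq _).2 (ConGen.Rel.of _ _ (PGRel.idem p))

theorem conGen_le_ker :
    conGen (PGRel S) ≤ Con.ker (FreeSemigroup.lift (fun p : Projections S => (p : S))) := by
  refine Con.conGen_le.2 ?_
  intro u v h
  rw [Con.ker_rel]
  cases h with
  | idem p => simpa using p.2.isIdempotentElem.eq
  | mul_idem p q => simpa using Projections.mul_mul_mul p q
  | theta p q => simp [Projections.theta]

/-- The canonical homomorphism `π : PG(P(S)) → S` with `x_p ↦ p`. -/
def toSemigroup (S : Type*) [Semigroup S] [RegularStarSemigroup S] : PG S →ₙ* S where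
  toFun w := Con.liftOn w (FreeSemigroup.lift (fun p : Projections S => (p : S)))
    fun _ _ h => conGen_le_ker h
  map_mul' u v := Con.induction_on₂ u v fun a b =>
    map_mul (FreeSemigroup.lift (fun p : Projections S => (p : S))) a b

theorem toSemigroup_x (p : Projections S) : toSemigroup S (x p) = p := rfl

end PG

/-! ### Green's relations and maximal subgroups -/

section Green

variable {S : Type*} [Semigroup S]

/-- `a ≤_R b`, i.e. `a S¹ ⊆ b S¹`, i.e. `a ∈ b S¹`. -/
def GreenRLe (a b : S) : Prop := a = b ∨ ∃ s, a = b * s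

/-- `a ≤_L b`, i.e. `S¹ a ⊆ S¹ b`, i.e. `a ∈ S¹ b`. -/
def GreenLLe (a b : S) : Prop := a = b ∨ ∃ s, a = s * b

/-- Green's relation `R`. -/
def GreenR (a b : S) : Prop := GreenRLe a b ∧ GreenRLe b a

/-- Green's relation `L`. -/
def GreenL (a b : S) : Prop := GreenLLe a b ∧ GreenLLe b a

/-- Green's relation `H = L ∩ R`. -/
def GreenH (a b : S) : Prop := GreenL a b ∧ GreenR a b

theorem GreenRLe.mul_eq {a e : S} (he : IsIdempotentElem e) (h : GreenRLe a e) : e * a = a := by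
  rcases h with rfl | ⟨s, rfl⟩
  · exact he
  · rw [← mul_assoc, he.eq]

theorem GreenLLe.mul_eq {a e : S} (he : IsIdempotentElem e) (h : GreenLLe a e) : a * e = a := by
  rcases h with rfl | ⟨s, rfl⟩
  · exact he
  · rw [mul_assoc, he.eq]

/-- The maximal subgroup of `S` containing the idempotent `e`: the `H`-class of `e`, with the
multiplication of `S`. -/
def maximalSubgroup (e : S) (he : IsIdempotentElem e) : Subsemigroup S where
  carrier := {a | GreenH a e}
  mul_mem' := by
    rintro a b ⟨⟨ha, ha'⟩, ⟨ha1, ha1'⟩⟩ ⟨⟨hb, hb'⟩, ⟨hb1, hb1'⟩⟩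
    have e1 := ha.mul_eq he
    have e2 := hb1.mul_eq he
    have aux : ∀ c : S, GreenRLe e c → ∃ s, e = c * s := by
      rintro c (rfl | h)
      · exact ⟨_, he.symm⟩
      · exact h
    have aux' : ∀ c : S, GreenLLe e c → ∃ s, e = s * c := by
      rintro c (rfl | h)
      · exact ⟨_, he.symm⟩
      · exact h
    obtain ⟨s, hs⟩ := aux a ha1'
    obtain ⟨t, ht⟩ := aux b hb1'
    obtain ⟨s', hs'⟩ := aux' a ha'
    obtain ⟨t', ht'⟩ := aux' b hb'
    refine ⟨⟨Or.inr ⟨a * b, ?_⟩, Or.inr ⟨t' * s', ?_⟩⟩, ⟨Or.inr ⟨a * b, ?_⟩, Or.inr ⟨t * s, ?_⟩⟩⟩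
    · rw [mul_assoc, hb.mul_eq he]
    · calc e = t' * (e * b) := by rw [e2, ← ht']
        _ = t' * s' * (a * b) := by rw [hs']; simp only [mul_assoc]
    · rw [← mul_assoc, ha1.mul_eq he]
    · calc e = a * e * s := by rw [e1, ← hs]
        _ = a * b * (t * s) := by rw [ht]; simp only [mul_assoc]

end Green

/-! ### The partition monoid -/

/-- The partition monoid over `X`: set partitions of `X ∪ X'`, encoded as equivalence relations on
`X ⊕ X`, where `Sum.inl x` is the upper vertex `x` and `Sum.inr x` is the lower vertex `x'`. -/
@[ext]
structure PartitionMonoid (X : Type*) where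
  rel : Setoid (X ⊕ X)

namespace PartitionMonoid

variable {X : Type*}

/-- The vertices of the product graph: upper row `X`, middle row `X''`, lower row `X'`. -/
inductive Vertex (X : Type*)
  | upper (x : X)
  | middle (x : X)
  | lower (x : X)

/-- Relabelling that changes the lower vertices `x'` to `x''`. -/
def toUpperHalf : X ⊕ X → Vertex X := Sum.elim Vertex.upper Vertex.middle

/-- Relabelling that changes the upper vertices `x` to `x''`. -/
def toLowerHalf : X ⊕ X → Vertex X := Sum.elim Vertex.middle Vertex.lower

/-- The inclusion of `X ∪ X'` in the vertex set of the product graph. -/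
def outer : X ⊕ X → Vertex X := Sum.elim Vertex.upper Vertex.lower

/-- Adjacency in the product graph of `a` and `b`. -/
inductive ProductGraph (a b : PartitionMonoid X) : Vertex X → Vertex X → Prop
  | left {u v : X ⊕ X} (h : a.rel u v) : ProductGraph a b (toUpperHalf u) (toUpperHalf v)
  | right {u v : X ⊕ X} (h : b.rel u v) : ProductGraph a b (toLowerHalf u) (toLowerHalf v)

/-- `u, v ∈ X ∪ X'` are in the same block of `ab` if and only if they are in the same connected
component of the product graph. -/
instance : Mul (PartitionMonoid X) where
  mul a b := ⟨Setoid.comap outer (Relation.EqvGen.setoid (ProductGraph a b))⟩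

theorem mul_rel (a b : PartitionMonoid X) (u v : X ⊕ X) :
    (a * b).rel u v ↔ Relation.EqvGen (ProductGraph a b) (outer u) (outer v) := Iff.rfl

/-- The involution: swap the upper and the lower vertices. -/
instance : Star (PartitionMonoid X) where
  star a := ⟨Setoid.comap Sum.swap a.rel⟩

/-- The two-colourings of the upper and lower rows that are constant on the blocks of `a`
(an auxiliary notion, for the proof of the laws of the multiplication). -/
def Compat (a : PartitionMonoid X) (f g : X → Prop) : Prop :=
  ∀ u v, a.rel u v → Sum.elim f g u = Sum.elim f g v

theorem ext_compat {a b : PartitionMonoid X} (h : ∀ f g, Compat a f g ↔ Compat b f g) : a = b := by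
  have key : ∀ (a b : PartitionMonoid X), (∀ f g, Compat b f g → Compat a f g) →
      ∀ u v, a.rel u v → b.rel u v := by
    intro a b h u v huv
    have hb : Compat b (fun x => b.rel u (Sum.inl x)) (fun x => b.rel u (Sum.inr x)) := by
      intro s t hst
      have e : ∀ w, Sum.elim (fun x => b.rel u (Sum.inl x)) (fun x => b.rel u (Sum.inr x)) w
          = b.rel u w := by rintro (w | w) <;> rfl
      rw [e, e]
      exact propext ⟨fun k => b.rel.trans' k hst, fun k => b.rel.trans' k (b.rel.symm' hst)⟩
    have := h _ _ hb u v huv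
    have e : ∀ w, Sum.elim (fun x => b.rel u (Sum.inl x)) (fun x => b.rel u (Sum.inr x)) w
          = b.rel u w := by rintro (w | w) <;> rfl
    rw [e, e] at this
    exact this ▸ b.rel.refl' u
  ext u v
  exact ⟨key a b (fun f g => (h f g).2) u v, key b a (fun f g => (h f g).1) u v⟩

theorem compat_mul (a b : PartitionMonoid X) (f g : X → Prop) :
    Compat (a * b) f g ↔ ∃ k, Compat a f k ∧ Compat b k g := by
  constructor
  · intro h
    let F : Vertex X → Prop := fun w =>
      ∃ u, Relation.EqvGen (ProductGraph a b) w (outer u) ∧ Sum.elim f g u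
    have hF : ∀ w w', ProductGraph a b w w' → F w = F w' := fun w w' hw => propext
      ⟨fun ⟨u, hu, hu'⟩ => ⟨u, .trans _ _ _ (.symm _ _ (.rel _ _ hw)) hu, hu'⟩,
        fun ⟨u, hu, hu'⟩ => ⟨u, .trans _ _ _ (.rel _ _ hw) hu, hu'⟩⟩
    have hO : ∀ u, F (outer u) = Sum.elim f g u := fun u => propext
      ⟨fun ⟨v, hv, hv'⟩ => (h u v hv) ▸ hv', fun hu => ⟨u, .refl _, hu⟩⟩
    have hf : ∀ x, F (.upper x) = f x := fun x => hO (.inl x)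
    have hg : ∀ x, F (.lower x) = g x := fun x => hO (.inr x)
    refine ⟨fun x => F (.middle x), ?_, ?_⟩
    · intro u v huv
      have := hF _ _ (ProductGraph.left (b := b) huv)
      rcases u with u | u <;> rcases v with v | v <;>
        simpa [toUpperHalf, hf] using this
    · intro u v huv
      have := hF _ _ (ProductGraph.right (a := a) huv)
      rcases u with u | u <;> rcases v with v | v <;>
        simpa [toLowerHalf, hg] using this
  · rintro ⟨k, ha, hb⟩
    let F : Vertex X → Prop := fun w => match w with
      | .upper x => f x
      | .middle x => k x
      | .lower x => g x
    have e1 : ∀ u, F (toUpperHalf u) = Sum.elim f k u := by rintro (u | u) <;> rfl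
    have e2 : ∀ u, F (toLowerHalf u) = Sum.elim k g u := by rintro (u | u) <;> rfl
    have e3 : ∀ u, F (outer u) = Sum.elim f g u := by rintro (u | u) <;> rfl
    have hF : ∀ w w', Relation.EqvGen (ProductGraph a b) w w' → F w = F w' := by
      intro w w' h
      induction h with
      | rel _ _ h =>
        cases h with
        | left h => rw [e1, e1]; exact ha _ _ h
        | right h => rw [e2, e2]; exact hb _ _ h
      | refl => rfl
      | symm _ _ _ ih => exact ih.symm
      | trans _ _ _ _ _ ih1 ih2 => exact ih1.trans ih2
    intro u v huv
    rw [← e3, ← e3]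
    exact hF _ _ huv

theorem compat_star (a : PartitionMonoid X) (f g : X → Prop) :
    Compat (star a) f g ↔ Compat a g f := by
  have e : ∀ (f g : X → Prop) u, Sum.elim f g u.swap = Sum.elim g f u := by
    rintro f g (u | u) <;> rfl
  constructor
  · intro h u v huv
    rw [← e f g u, ← e f g v]
    refine h _ _ ?_
    change a.rel u.swap.swap v.swap.swap
    simpa using huv
  · intro h u v huv
    rw [← e g f u, ← e g f v]
    exact h _ _ huv

instance : Semigroup (PartitionMonoid X) where
  mul_assoc a b c := ext_compat fun f g => by
    simp only [compat_mul]
    exact ⟨fun ⟨k, ⟨l, h1, h2⟩, h3⟩ => ⟨l, h1, k, h2, h3⟩,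
      fun ⟨l, h1, k, h2, h3⟩ => ⟨k, ⟨l, h1, h2⟩, h3⟩⟩

instance : RegularStarSemigroup (PartitionMonoid X) where
  star_involutive a := ext_compat fun f g => by simp only [compat_star]
  star_mul a b := ext_compat fun f g => by
    simp only [compat_star, compat_mul]
    exact ⟨fun ⟨k, h1, h2⟩ => ⟨k, h2, h1⟩, fun ⟨k, h1, h2⟩ => ⟨k, h2, h1⟩⟩
  mul_star_mul_self a := ext_compat fun f g => by
    simp only [compat_star, compat_mul]
    constructor
    · rintro ⟨k, ⟨l, h1, h2⟩, h3⟩ u v huv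
      have e1 := h1 u v huv
      have e2 := h2 u v huv
      have e3 := h3 u v huv
      rcases u with u | u <;> rcases v with v | v <;> simp_all
    · exact fun h => ⟨f, ⟨g, h, h⟩, h⟩

/-- The rank: the number of transversals, i.e. of blocks that meet both rows. -/
noncomputable def rank (a : PartitionMonoid X) : ℕ :=
  {B ∈ a.rel.classes | (∃ x, Sum.inl x ∈ B) ∧ ∃ y, Sum.inr y ∈ B}.ncard

end PartitionMonoid

/-!
Let `p` be a projection of rank `r ≤ |X| - 2`. An element of `PG` over the `R`-class of `p` has a
normal form `lift c * x (merge m)`, where the configuration `c` places the `r` transversals at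
distinct points and `m` is a partition of the lower row. The lifts of a configuration are carried
to those of a neighbouring one, where a single point has moved, by multiplication with two
generators. These transports are compatible along triangles, in which one point moves twice, and
along squares, in which two points move independently. As there are two free positions, the graph
of configurations becomes simply connected when the triangles and squares are filled in, which is
seen by forgetting the points one at a time. Hence there is a coherent choice of `lift c`, with
which the normal form is determined by its image in the partition monoid. So the canonical map is
injective over the `R`-class of `p`, and the maximal subgroup containing `x p` is the one
containing `p`.
-/

/-! ### Flat sections of local systems on configuration graphs -/

section AgreeOff

variable {ι X : Type*} {i : ι} {c c' c'' : ι ↪ X}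

/-- The edges of the configuration graph: `c` and `c'` differ at most in the position of the point
labelled `i`. -/
def AgreeOff (i : ι) (c c' : ι ↪ X) : Prop := ∀ j, j ≠ i → c j = c' j

theorem AgreeOff.refl (i : ι) (c : ι ↪ X) : AgreeOff i c c := fun _ _ => rfl

theorem AgreeOff.trans (h : AgreeOff i c c') (h' : AgreeOff i c' c'') : AgreeOff i c c'' :=
  fun j hj => (h j hj).trans (h' j hj)

theorem AgreeOff.notMem_range (h : AgreeOff i c c') {z : X} (hz : z ∉ Set.range c)
    (hi : z ≠ c' i) : z ∉ Set.range c' := by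
  rintro ⟨j, rfl⟩
  by_cases hj : j = i
  · exact hi (by rw [hj])
  · exact hz ⟨j, h j hj⟩

end AgreeOff

section Tail

open Fin.Embedding

variable {X : Type*} {r : ℕ}

theorem agreeOff_zero_of_tail_eq {d d' : Fin (r + 1) ↪ X} (h : tail d = tail d') :
    AgreeOff 0 d d' := by
  intro j hj
  obtain ⟨k, rfl⟩ := Fin.exists_succ_eq.2 hj
  exact DFunLike.congr_fun h k

theorem AgreeOff.tail_eq {d d' : Fin (r + 1) ↪ X} (h : AgreeOff 0 d d') : tail d = tail d' :=
  DFunLike.ext _ _ fun k => h k.succ (Fin.succ_ne_zero k)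

theorem AgreeOff.tail {i : Fin r} {d d' : Fin (r + 1) ↪ X} (h : AgreeOff i.succ d d') :
    AgreeOff i (tail d) (tail d') :=
  fun k hk => h k.succ (by simpa using hk)

theorem AgreeOff.cons {i : Fin r} {c c' : Fin r ↪ X} (h : AgreeOff i c c') {z : X}
    (hz : z ∉ Set.range c) (hz' : z ∉ Set.range c') :
    AgreeOff i.succ (cons c hz) (cons c' hz') := by
  intro j hj
  cases j using Fin.cases with
  | zero => rfl
  | succ k => exact h k fun hk => hj (by rw [hk])

theorem exists_notMem_range (hX : (r : ℕ∞) + 3 ≤ ENat.card X) (c : Fin r ↪ X) (x y : X) :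
    ∃ z, z ∉ Set.range c ∧ z ≠ x ∧ z ≠ y := by
  by_contra! h
  have hle : ENat.card X ≤ r + 2 := calc
    ENat.card X = (Set.univ : Set X).encard := (Set.encard_univ X).symm
    _ ≤ (Set.range c ∪ {x, y}).encard := Set.encard_le_encard fun z _ => by
        by_cases hz : z ∈ Set.range c
        · exact .inl hz
        · exact .inr (or_iff_not_imp_left.2 (h z hz))
    _ ≤ (Set.range c).encard + ({x, y} : Set X).encard := Set.encard_union_le _ _
    _ ≤ r + 2 := by
        gcongr
        · rw [← Set.image_univ]
          exact (Set.encard_image_le _ _).trans (by simp)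
        · exact (Set.encard_insert_le _ _).trans (by simp [one_add_one_eq_two])
  exact absurd (hX.trans hle) (by norm_cast; omega)

theorem AgreeOff.exists_notMem_range (hX : (r : ℕ∞) + 3 ≤ ENat.card X) {i : Fin r}
    {c c' : Fin r ↪ X} (h : AgreeOff i c c') (x : X) :
    ∃ z, z ∉ Set.range c ∧ z ∉ Set.range c' ∧ z ≠ x := by
  obtain ⟨z, hz, hzi, hzx⟩ := _root_.exists_notMem_range hX c (c' i) x
  exact ⟨z, hz, h.notMem_range hz hzi, hzx⟩

end Tail

universe u

/-- A local system on the configuration graph of `ι` in `X`: fibres over the configurations, and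
transports along the edges that compose along triangles (one point moves twice) and commute around
squares (two points move independently). -/
structure LocalSystem (ι : Type*) (X : Type u) where
  fib : (ι ↪ X) → Type u
  tr {i : ι} {c c' : ι ↪ X} : AgreeOff i c c' → fib c → fib c'
  tr_refl (i : ι) (c : ι ↪ X) (w : fib c) : tr (AgreeOff.refl i c) w = w
  tr_tr {i : ι} {c c' c'' : ι ↪ X} (h : AgreeOff i c c') (h' : AgreeOff i c' c'') (w : fib c) :
    tr h' (tr h w) = tr (h.trans h') w
  tr_square {i j : ι} {c₁ c₂ c₃ c₄ : ι ↪ X} : i ≠ j →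
    ∀ (h₁₂ : AgreeOff i c₁ c₂) (h₂₃ : AgreeOff j c₂ c₃) (h₁₄ : AgreeOff j c₁ c₄)
      (h₄₃ : AgreeOff i c₄ c₃) (w : fib c₁), tr h₂₃ (tr h₁₂ w) = tr h₄₃ (tr h₁₄ w)

namespace LocalSystem

open Fin.Embedding

variable {X : Type u} {r : ℕ} {L : LocalSystem (Fin (r + 1)) X}

/-- The flat sections of `L` over the configurations that extend `c` by a new point with the
label `0`. They form the fibre over `c` of a local system with one point less. -/
@[ext]
structure FlatExtension (L : LocalSystem (Fin (r + 1)) X) (c : Fin r ↪ X) where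
  val (d : Fin (r + 1) ↪ X) : tail d = c → L.fib d
  tr_val ⦃d d' : Fin (r + 1) ↪ X⦄ (hd : tail d = c) (hd' : tail d' = c) :
    L.tr (agreeOff_zero_of_tail_eq (hd.trans hd'.symm)) (val d hd) = val d' hd'

namespace FlatExtension

variable {c c' : Fin r ↪ X} {d d' : Fin (r + 1) ↪ X}

theorem ext_of_val_eq {φ ψ : L.FlatExtension c} (hd : tail d = c)
    (h : φ.val d hd = ψ.val d hd) : φ = ψ := by
  ext d' hd'
  rw [← φ.tr_val hd hd', ← ψ.tr_val hd hd', h]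

/-- The flat extension with a given value at one point. -/
def ofVal (hd : tail d = c) (w : L.fib d) : L.FlatExtension c where
  val _ hd' := L.tr (agreeOff_zero_of_tail_eq (hd.trans hd'.symm)) w
  tr_val _ _ _ _ := L.tr_tr _ _ w

theorem ofVal_val_self (hd : tail d = c) (w : L.fib d) : (ofVal hd w).val d hd = w :=
  L.tr_refl 0 d w

variable {i : Fin r}

theorem exists_transport (hX : (r : ℕ∞) + 3 ≤ ENat.card X) (h : AgreeOff i c c')
    (φ : L.FlatExtension c) :
    ∃ ψ : L.FlatExtension c', ∀ {d d' : Fin (r + 1) ↪ X} (hd : tail d = c) (hd' : tail d' = c')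
      (hdd' : AgreeOff i.succ d d'), L.tr hdd' (φ.val d hd) = ψ.val d' hd' := by
  obtain ⟨z, hz, hz', -⟩ := h.exists_notMem_range hX (c i)
  refine ⟨ofVal (tail_cons c' hz') (L.tr (h.cons hz hz') (φ.val _ (tail_cons c hz))), ?_⟩
  intro d d' hd hd' hdd'
  rw [← φ.tr_val (tail_cons c hz) hd]
  exact L.tr_square (Fin.succ_ne_zero i).symm _ _ _ _ _

/-- The transport of flat extensions, which moves all the points of the fibre simultaneously. -/
noncomputable def transport (hX : (r : ℕ∞) + 3 ≤ ENat.card X) (h : AgreeOff i c c')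
    (φ : L.FlatExtension c) : L.FlatExtension c' :=
  (exists_transport hX h φ).choose

theorem transport_val (hX : (r : ℕ∞) + 3 ≤ ENat.card X) (h : AgreeOff i c c')
    (φ : L.FlatExtension c) (hd : tail d = c) (hd' : tail d' = c')
    (hdd' : AgreeOff i.succ d d') :
    (φ.transport hX h).val d' hd' = L.tr hdd' (φ.val d hd) :=
  ((exists_transport hX h φ).choose_spec hd hd' hdd').symm

end FlatExtension

open FlatExtension

/-- The local system of flat extensions of `L`. -/
noncomputable def dropZero (L : LocalSystem (Fin (r + 1)) X) (hX : (r : ℕ∞) + 3 ≤ ENat.card X) :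
    LocalSystem (Fin r) X where
  fib := L.FlatExtension
  tr h φ := φ.transport hX h
  tr_refl i c φ := by
    obtain ⟨z, hz, -⟩ := exists_notMem_range hX c (c i) (c i)
    apply ext_of_val_eq (tail_cons c hz)
    rw [transport_val hX _ φ (tail_cons c hz) (tail_cons c hz) (.refl _ _), L.tr_refl]
  tr_tr {i c c' c''} h h' φ := by
    obtain ⟨z, hz, hz', hzi⟩ := h.exists_notMem_range hX (c'' i)
    have hz'' := h'.notMem_range hz' hzi
    apply ext_of_val_eq (tail_cons c'' hz'')
    rw [transport_val hX h' _ (tail_cons c' hz') _ (h'.cons hz' hz''),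
      transport_val hX h φ (tail_cons c hz) _ (h.cons hz hz'), L.tr_tr,
      transport_val hX (h.trans h') φ (tail_cons c hz)]
  tr_square {i j c₁ c₂ c₃ c₄} hij h₁₂ h₂₃ h₁₄ h₄₃ φ := by
    obtain ⟨z, hz₁, hz₂, hz⟩ := h₁₂.exists_notMem_range hX (c₄ j)
    have hz₄ := h₁₄.notMem_range hz₁ hz
    have hz₃ := h₂₃.notMem_range hz₂ (by rwa [← h₄₃ j hij.symm])
    apply ext_of_val_eq (tail_cons c₃ hz₃)
    rw [transport_val hX h₂₃ _ (tail_cons c₂ hz₂) _ (h₂₃.cons hz₂ hz₃),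
      transport_val hX h₁₂ φ (tail_cons c₁ hz₁) _ (h₁₂.cons hz₁ hz₂),
      transport_val hX h₄₃ _ (tail_cons c₄ hz₄) _ (h₄₃.cons hz₄ hz₃),
      transport_val hX h₁₄ φ (tail_cons c₁ hz₁) _ (h₁₄.cons hz₁ hz₄),
      L.tr_square (by simpa using hij)]

/-- With two free positions, the configuration graph with its triangles and squares filled in is
simply connected. -/
theorem exists_flat_section {r : ℕ} (L : LocalSystem (Fin r) X)
    (hX : (r : ℕ∞) + 2 ≤ ENat.card X) (c₀ : Fin r ↪ X) (w₀ : L.fib c₀) :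
    ∃ s : ∀ c, L.fib c, s c₀ = w₀ ∧
      ∀ {i : Fin r} {c c' : Fin r ↪ X} (h : AgreeOff i c c'), L.tr h (s c) = s c' := by
  induction r with
  | zero => exact ⟨fun c => (Subsingleton.elim c₀ c) ▸ w₀, rfl, fun {i} => i.elim0⟩
  | succ r ih =>
    have hX' : (r : ℕ∞) + 3 ≤ ENat.card X := le_of_eq_of_le (by push_cast; ring) hX
    obtain ⟨(s : ∀ c, L.FlatExtension c), hs₀, hs⟩ := ih (L.dropZero hX')
      (le_trans (by gcongr; norm_num) hX') (tail c₀) (ofVal rfl w₀)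
    refine ⟨fun d => (s (tail d)).val d rfl, ?_, ?_⟩
    · dsimp only
      rw [hs₀]
      exact ofVal_val_self rfl w₀
    · intro i d d' h
      dsimp only
      cases i using Fin.cases with
      | zero =>
        have val_eq : ∀ {c} (hc : tail d' = c), (s c).val d' hc = (s (tail d')).val d' rfl := by
          rintro _ rfl
          rfl
        exact ((s (tail d)).tr_val rfl h.tail_eq.symm).trans (val_eq _)
      | succ j =>
        rw [← hs h.tail]
        exact (transport_val hX' h.tail _ rfl rfl h).symm

end LocalSystem

/-! ### Green's relations -/

section Green

variable {S T : Type*} [Semigroup S] [Semigroup T] {a b c e f : S}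

theorem GreenRLe.trans (hab : GreenRLe a b) (hbc : GreenRLe b c) : GreenRLe a c := by
  rcases hbc with rfl | ⟨t, rfl⟩
  · exact hab
  · rcases hab with rfl | ⟨s, rfl⟩
    · exact .inr ⟨t, rfl⟩
    · exact .inr ⟨t * s, mul_assoc _ _ _⟩

theorem greenRLe_mul_right (a s : S) : GreenRLe (a * s) a := .inr ⟨s, rfl⟩

theorem greenLLe_mul_left (s a : S) : GreenLLe (s * a) a := .inr ⟨s, rfl⟩

theorem GreenLLe.mul_right (h : GreenLLe a b) (c : S) : GreenLLe (a * c) (b * c) := by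
  rcases h with rfl | ⟨s, rfl⟩
  · exact .inl rfl
  · exact .inr ⟨s, mul_assoc _ _ _⟩

theorem GreenRLe.map (φ : S →ₙ* T) (h : GreenRLe a b) : GreenRLe (φ a) (φ b) :=
  h.imp (congrArg φ) fun ⟨s, hs⟩ => ⟨φ s, by rw [hs, map_mul]⟩

theorem GreenLLe.map (φ : S →ₙ* T) (h : GreenLLe a b) : GreenLLe (φ a) (φ b) :=
  h.imp (congrArg φ) fun ⟨s, hs⟩ => ⟨φ s, by rw [hs, map_mul]⟩

theorem mul_mem_maximalSubgroup (he : IsIdempotentElem e) (hf : IsIdempotentElem f)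
    (h : GreenR e f) (ha : a ∈ maximalSubgroup e he) : a * f ∈ maximalSubgroup f hf := by
  obtain ⟨⟨hae, hea⟩, hae', hea'⟩ := ha
  refine ⟨⟨greenLLe_mul_left a f, ?_⟩, (greenRLe_mul_right a f).trans (hae'.trans h.1), ?_⟩
  · simpa only [h.2.mul_eq he] using hea.mul_right f
  · have hafe : a * f * e = a := by rw [mul_assoc, h.1.mul_eq hf, hae.mul_eq he]
    exact h.2.trans (hea'.trans (.inr ⟨e, hafe.symm⟩))

/-- The isomorphism `a ↦ a * f` between the maximal subgroups containing the `R`-related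
idempotents `e` and `f`. -/
def GreenR.maximalSubgroupEquiv (h : GreenR e f) (he : IsIdempotentElem e)
    (hf : IsIdempotentElem f) : maximalSubgroup e he ≃* maximalSubgroup f hf where
  toFun a := ⟨a * f, mul_mem_maximalSubgroup he hf h a.2⟩
  invFun a := ⟨a * e, mul_mem_maximalSubgroup hf he h.symm a.2⟩
  left_inv a := Subtype.ext <| by
    simp only [mul_assoc, h.1.mul_eq hf, a.2.1.1.mul_eq he]
  right_inv a := Subtype.ext <| by
    simp only [mul_assoc, h.2.mul_eq he, a.2.1.1.mul_eq hf]
  map_mul' a b := Subtype.ext <| by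
    have hfb : f * (b : S) = b := (b.2.2.1.trans h.1).mul_eq hf
    calc (a * b * f : S) = a * (f * b) * f := by rw [hfb]
      _ = a * f * (b * f) := by simp only [mul_assoc]

/-- The maximal subgroup containing `e` is isomorphic to any group that is embedded in `S`, with
identity `e` and containing the `H`-class of `e`. -/
noncomputable def mulEquivMaximalSubgroup {G : Type*} [Group G] (φ : G →ₙ* S)
    (hφ : Function.Injective φ) (he : IsIdempotentElem e) (h_one : φ 1 = e)
    (hsurj : ∀ a, GreenH a e → a ∈ Set.range φ) : G ≃* maximalSubgroup e he :=
  have hmem (g : G) : φ g ∈ maximalSubgroup e he := by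
    subst h_one
    refine ⟨⟨.inr ⟨φ g, ?_⟩, .inr ⟨φ g⁻¹, ?_⟩⟩, .inr ⟨φ g, ?_⟩, .inr ⟨φ g⁻¹, ?_⟩⟩ <;>
      simp [← map_mul]
  MulEquiv.ofBijective (φ.codRestrict _ hmem)
    ⟨fun _ _ h => hφ (congrArg Subtype.val h), fun a => (hsurj a a.2).imp fun _ => Subtype.ext⟩

end Green

/-! ### Consequences of the defining relations -/

namespace PG

variable {S : Type*} [Semigroup S] [RegularStarSemigroup S]

theorem x_mul_self (p : Projections S) : x p * x p = x p := isIdempotentElem_x p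

theorem isIdempotentElem_x_mul_x (p q : Projections S) : IsIdempotentElem (x p * x q) :=
  (Con.eq _).2 (.of _ _ (.mul_idem p q))

theorem x_mul_x_mul_x {p q t : Projections S} (h : (p * q * p : S) = t) :
    x p * x q * x p = x t := by
  obtain rfl : p.theta q = t := Subtype.ext h
  exact (Con.eq _).2 (.of _ _ (.theta p q))

theorem x_mul_x {p q t : Projections S} (h : (p * q : S) = t) : x p * x q = x t := by
  have hqp : (q * p : S) = t := by
    rw [← t.2.isSelfAdjoint.star_eq, ← h, star_mul, p.2.isSelfAdjoint.star_eq,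
      q.2.isSelfAdjoint.star_eq]
  have hpt : (p * t : S) = t := by rw [← h, ← mul_assoc, p.2.isIdempotentElem.eq]
  have hqt : (q * t : S) = t := by rw [← hqp, ← mul_assoc, q.2.isIdempotentElem.eq]
  have htq : (t * q : S) = t := by rw [← h, mul_assoc, q.2.isIdempotentElem.eq]
  have hpqp : x p * x q * x p = x t := x_mul_x_mul_x (by rw [mul_assoc, hqp, hpt])
  have hqtq : x q * x t * x q = x t := x_mul_x_mul_x (by rw [hqt, htq])
  calc x p * x q = x p * x q * x p * x q := by
        rw [mul_assoc (x p * x q), (isIdempotentElem_x_mul_x p q).eq]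
    _ = x q * x t * (x q * x q) := by rw [hpqp, ← mul_assoc, hqtq]
    _ = x t := by rw [x_mul_self, hqtq]

theorem x_mul_x_mul_x_eq {p q a b : Projections S} (h : (p * q * p : S) = a * b) :
    x p * x q * x p = x a * x b := by
  rw [x_mul_x_mul_x (t := p.theta q) rfl, x_mul_x (t := p.theta q) h.symm]

theorem induction_on {C : PG S → Prop} (w : PG S) (x : ∀ p, C (x p))
    (x_mul : ∀ p w, C w → C (PG.x p * w)) : C w := by
  induction w using Con.induction_on with
  | H w => induction w with
    | ih1 p => exact x p
    | ih2 p w _ hw => exact x_mul p _ hw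

end PG

section LeftProj

variable {S : Type*} [Semigroup S] [RegularStarSemigroup S]

/-- The projection `a a*`. -/
def leftProj (a : S) : Projections S where
  val := a * star a
  property :=
    { isIdempotentElem := by
        rw [IsIdempotentElem, ← mul_assoc, RegularStarSemigroup.mul_star_mul_self]
      isSelfAdjoint := .mul_star_self a }

theorem leftProj_mul_self (a : S) : leftProj a * a = a := RegularStarSemigroup.mul_star_mul_self a

theorem greenR_leftProj (a : S) : GreenR a (leftProj a) :=
  ⟨.inr ⟨a, (leftProj_mul_self a).symm⟩, .inr ⟨star a, rfl⟩⟩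

theorem leftProj_coe (p : Projections S) : leftProj (p : S) = p :=
  Subtype.ext <| (congrArg _ p.2.isSelfAdjoint.star_eq).trans p.2.isIdempotentElem

theorem leftProj_mul (p : Projections S) (a : S) :
    (leftProj (p * a) : S) = p * leftProj a * p := by
  simp only [leftProj, star_mul, p.2.isSelfAdjoint.star_eq, mul_assoc]

end LeftProj

namespace PG

variable {S : Type*} [Semigroup S] [RegularStarSemigroup S]

theorem x_leftProj_mul (w : PG S) : x (leftProj (toSemigroup S w)) * w = w := by
  induction w using PG.induction_on with
  | x p => exact x_mul_x (leftProj_mul_self (p : S))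
  | x_mul p w hw =>
    rw [map_mul, toSemigroup_x]
    set f := leftProj (toSemigroup S w)
    calc x (leftProj (p * toSemigroup S w)) * (x p * w)
        = x p * x f * (x p * x p) * w := by
          rw [← x_mul_x_mul_x (leftProj_mul p _).symm]
          simp only [f, mul_assoc]
      _ = x p * x f * (x p * x f) * w := by
          rw [x_mul_self]
          nth_rw 1 [← hw]
          simp only [mul_assoc]
      _ = x p * w := by rw [(isIdempotentElem_x_mul_x p f).eq, mul_assoc, hw]

theorem x_mul_of_greenRLe {q : Projections S} {w : PG S} (h : GreenRLe (toSemigroup S w) q) :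
    x q * w = w := by
  have hq : x q * x (leftProj (toSemigroup S w)) = x (leftProj (toSemigroup S w)) :=
    x_mul_x <| by rw [leftProj, ← mul_assoc, h.mul_eq q.2.isIdempotentElem]
  rw [← x_leftProj_mul w, ← mul_assoc, hq]

theorem exists_isIdempotentElem_toSemigroup_eq {e : S} (he : IsIdempotentElem e) :
    ∃ f : PG S, IsIdempotentElem f ∧ toSemigroup S f = e := by
  refine ⟨x (leftProj e) * x (leftProj (star e)), isIdempotentElem_x_mul_x _ _, ?_⟩
  calc e * star e * (star e * star (star e)) = e * star (e * e) * e := by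
        rw [star_star, star_mul]; simp only [mul_assoc]
    _ = e := by rw [he.eq, RegularStarSemigroup.mul_star_mul_self]

end PG

/-! ### Partitions generated by two kernels and a family of transversals -/

section Setoids

variable {X ι : Type*} {m m' : Setoid X} {c c' : ι → X}

theorem le_ker_rel (m : Setoid X) (x : X) : m ≤ Setoid.ker (m x) := fun _ _ h =>
  propext ⟨fun k => m.trans' k h, fun k => m.trans' k (m.symm' h)⟩

theorem setoid_le_of_forall_le_ker
    (h : ∀ f : X → Prop, m' ≤ Setoid.ker f → m ≤ Setoid.ker f) : m ≤ m' := fun x _ hxy =>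
  (h _ (le_ker_rel m' x) hxy).mp (m'.refl' x)

/-- The points `c i` are in different classes of `m`. -/
def Separates (m : Setoid X) (c : ι → X) : Prop := ∀ ⦃i j⦄, m (c i) (c j) → i = j

theorem Separates.injective (h : Separates m c) : Function.Injective c :=
  fun _ _ hij => h (hij ▸ m.refl' _)

theorem Separates.of_rel (h : Separates m c) (hc : ∀ i, m (c i) (c' i)) : Separates m c' :=
  fun i j hij => h (m.trans' (hc i) (m.trans' hij (m.symm' (hc j))))

theorem Separates.exists_extension (h : Separates m c) (φ : ι → Prop) :
    ∃ f : X → Prop, m ≤ Setoid.ker f ∧ ∀ i, f (c i) = φ i := by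
  refine ⟨fun x => ∃ i, m (c i) x ∧ φ i, fun x y hxy => ?_, fun i => propext ?_⟩
  · exact propext <| exists_congr fun i => and_congr_left fun _ =>
      ⟨fun h => m.trans' h hxy, fun h => m.trans' h (m.symm' hxy)⟩
  · exact ⟨fun ⟨j, hji, hj⟩ => h hji ▸ hj, fun hi => ⟨i, m.refl' _, hi⟩⟩

/-- The smallest equivalence relation that relates `c i` and `c' i` for all `i`. -/
def link (c c' : ι → X) : Setoid X :=
  Relation.EqvGen.setoid fun x y => ∃ i, c i = x ∧ c' i = y

theorem link_le : link c c' ≤ m ↔ ∀ i, m (c i) (c' i) := by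
  refine ⟨fun h i => h (.rel _ _ ⟨i, rfl, rfl⟩), fun h => Setoid.eqvGen_le ?_⟩
  rintro _ _ ⟨i, rfl, rfl⟩
  exact h i

/-- The restriction of `m` to `Y`, with the points outside `Y` isolated. -/
def isolate (m : Setoid X) (Y : Set X) : Setoid X where
  r x y := x = y ∨ (x ∈ Y ∧ y ∈ Y ∧ m x y)
  iseqv := by
    refine ⟨fun x => .inl rfl, ?_, ?_⟩
    · rintro x y (rfl | ⟨hx, hy, hxy⟩)
      exacts [.inl rfl, .inr ⟨hy, hx, m.symm' hxy⟩]
    · rintro x y z (rfl | ⟨hx, hy, hxy⟩) (rfl | ⟨hy', hz, hyz⟩)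
      exacts [.inl rfl, .inr ⟨hy', hz, hyz⟩, .inr ⟨hx, hy, hxy⟩, .inr ⟨hx, hz, m.trans' hxy hyz⟩]

theorem isolate_le (m : Setoid X) (Y : Set X) : isolate m Y ≤ m := by
  rintro x y (rfl | ⟨-, -, h⟩)
  exacts [m.refl' x, h]

theorem Separates.isolate (h : Separates m c) (Y : Set X) : Separates (isolate m Y) c :=
  fun _ _ hij => h (isolate_le m Y hij)

end Setoids

namespace PartitionMonoid

variable {X ι : Type*} {a b : PartitionMonoid X} {m₀ m m' : Setoid X} {c₀ c c' : ι → X} {Y : Set X}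
  {f g : X → Prop}

theorem isStarProjection_of_compat (hsymm : ∀ f g, Compat a f g → Compat a g f)
    (htrans : ∀ f g k, Compat a f g → Compat a g k → Compat a f k) : IsStarProjection a where
  isIdempotentElem := ext_compat fun f g => by
    rw [compat_mul]
    exact ⟨fun ⟨k, hfk, hkg⟩ => htrans f k g hfk hkg,
      fun h => ⟨f, htrans f g f h (hsymm f g h), h⟩⟩
  isSelfAdjoint := ext_compat fun f g => by
    rw [compat_star]
    exact ⟨hsymm g f, hsymm f g⟩

/-- The generating relation of `connect m₀ c₀ c m`. -/
inductive ConnectRel (m₀ : Setoid X) (c₀ c : ι → X) (m : Setoid X) : X ⊕ X → X ⊕ X → Prop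
  | upper {x y : X} (h : m₀ x y) : ConnectRel m₀ c₀ c m (.inl x) (.inl y)
  | lower {x y : X} (h : m x y) : ConnectRel m₀ c₀ c m (.inr x) (.inr y)
  | transversal (i : ι) : ConnectRel m₀ c₀ c m (.inl (c₀ i)) (.inr (c i))

/-- The partition generated by `m₀` on the upper row, `m` on the lower row, and the edges from
the upper points `c₀ i` to the lower points `c i`. -/
def connect (m₀ : Setoid X) (c₀ c : ι → X) (m : Setoid X) : PartitionMonoid X :=
  ⟨Relation.EqvGen.setoid (ConnectRel m₀ c₀ c m)⟩

theorem compat_connect :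
    Compat (connect m₀ c₀ c m) f g ↔
      m₀ ≤ Setoid.ker f ∧ m ≤ Setoid.ker g ∧ ∀ i, f (c₀ i) = g (c i) := by
  constructor
  · exact fun h => ⟨fun x y hxy => h _ _ (.rel _ _ (.upper hxy)),
      fun x y hxy => h _ _ (.rel _ _ (.lower hxy)), fun i => h _ _ (.rel _ _ (.transversal i))⟩
  · rintro ⟨hf, hg, hc⟩
    have hle : (connect m₀ c₀ c m).rel ≤ Setoid.ker (Sum.elim f g) := Setoid.eqvGen_le <| by
      rintro _ _ (h | h | i)
      exacts [hf h, hg h, hc i]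
    exact fun _ _ huv => hle huv

/-- The projection with kernel generated by `m` whose transversals are the blocks of the
points `c i`. -/
def proj (m : Setoid X) (c : ι → X) : Projections (PartitionMonoid X) where
  val := connect m c c m
  property := by
    refine isStarProjection_of_compat (fun f g => ?_) (fun f g k => ?_) <;>
      simp only [compat_connect]
    · exact fun ⟨hf, hg, hc⟩ => ⟨hg, hf, fun i => (hc i).symm⟩
    · exact fun ⟨hf, _, hc⟩ ⟨_, hk, hc'⟩ => ⟨hf, hk, fun i => (hc i).trans (hc' i)⟩

theorem compat_proj :
    Compat (proj m c : PartitionMonoid X) f g ↔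
      m ≤ Setoid.ker f ∧ m ≤ Setoid.ker g ∧ ∀ i, f (c i) = g (c i) := compat_connect

/-- The projection with blocks `A ∪ A'`, where `A` is a class of `m`. -/
def merge (m : Setoid X) : Projections (PartitionMonoid X) := proj m id

theorem compat_merge : Compat (merge m : PartitionMonoid X) f g ↔ f = g ∧ m ≤ Setoid.ker f := by
  rw [merge, compat_proj]
  constructor
  · exact fun ⟨hf, _, h⟩ => ⟨funext h, hf⟩
  · rintro ⟨rfl, hf⟩
    exact ⟨hf, hf, fun _ => rfl⟩

/-- The projection with blocks `{x, x'}` for `x ∈ Y`, and singletons. -/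
def restrict (Y : Set X) : Projections (PartitionMonoid X) := proj ⊥ ((↑) : Y → X)

theorem compat_restrict : Compat (restrict Y : PartitionMonoid X) f g ↔ ∀ x ∈ Y, f x = g x := by
  simp only [restrict, compat_proj, bot_le, true_and, Subtype.forall]

/-- The kernel of a partition: the restriction to the upper row. -/
def ker (a : PartitionMonoid X) : Setoid X := Setoid.comap Sum.inl a.rel

theorem compat_of_ker_le (hf : ker a ≤ Setoid.ker f) :
    Compat a f fun y => ∃ x, a.rel (.inl x) (.inr y) ∧ f x := by
  have hul {x y : X} (h : a.rel (.inl x) (.inr y)) :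
      f x = ∃ x', a.rel (.inl x') (.inr y) ∧ f x' := by
    refine propext ⟨fun hx => ⟨x, h, hx⟩, fun ⟨x', h', hx'⟩ => ?_⟩
    exact (hf (a.rel.trans' h' (a.rel.symm' h) : ker a x' x)).mp hx'
  rintro (x | x) (y | y) h
  · exact hf h
  · exact hul h
  · exact (hul (a.rel.symm' h)).symm
  · exact propext <| exists_congr fun z => and_congr_left fun _ =>
      ⟨fun hz => a.rel.trans' hz h, fun hz => a.rel.trans' hz (a.rel.symm' h)⟩

theorem leftProj_eq_proj (hc : ∀ i, ∃ y, a.rel (.inl (c i)) (.inr y))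
    (hcover : ∀ {x y}, a.rel (.inl x) (.inr y) → ∃ i, ker a (c i) x) :
    leftProj a = proj (ker a) c := by
  refine Subtype.ext (ext_compat fun f g => ?_)
  change Compat (a * star a) f g ↔ _
  simp only [compat_mul, compat_star, compat_proj]
  constructor
  · rintro ⟨k, hf, hg⟩
    refine ⟨fun _ _ h => hf _ _ h, fun _ _ h => hg _ _ h, fun i => ?_⟩
    obtain ⟨y, hy⟩ := hc i
    exact (hf _ _ hy).trans (hg _ _ hy).symm
  · rintro ⟨hf, hg, hfg⟩
    have heq {x y : X} (h : a.rel (.inl x) (.inr y)) : f x = g x := by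
      obtain ⟨i, hi⟩ := hcover h
      exact (hf hi).symm.trans ((hfg i).trans (hg hi))
    refine ⟨_, compat_of_ker_le hf, ?_⟩
    convert compat_of_ker_le hg using 4 with y x
    exact and_congr_right fun hxy => (heq hxy).to_iff

theorem exists_compat_of_greenRLe (h : GreenRLe a b) (hf : Compat a f g) :
    ∃ k, Compat b f k := by
  rcases h with rfl | ⟨s, rfl⟩
  · exact ⟨g, hf⟩
  · obtain ⟨k, hk, -⟩ := (compat_mul _ _ _ _).1 hf
    exact ⟨k, hk⟩

theorem exists_compat_of_greenLLe (h : GreenLLe a b) (hg : Compat a f g) :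
    ∃ k, Compat b k g := by
  rcases h with rfl | ⟨s, rfl⟩
  · exact ⟨f, hg⟩
  · obtain ⟨k, -, hk⟩ := (compat_mul _ _ _ _).1 hg
    exact ⟨k, hk⟩

theorem compat_bot_of_greenRLe (h : GreenRLe a b) (hf : Compat b f ⊥) : Compat a f ⊥ := by
  rcases h with rfl | ⟨s, rfl⟩
  · exact hf
  · refine (compat_mul _ _ _ _).2 ⟨⊥, hf, ?_⟩
    rintro (u | u) (v | v) - <;> rfl

theorem compat_bot_of_greenLLe (h : GreenLLe a b) (hg : Compat b ⊥ g) : Compat a ⊥ g := by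
  rcases h with rfl | ⟨s, rfl⟩
  · exact hg
  · refine (compat_mul _ _ _ _).2 ⟨⊥, ?_, hg⟩
    rintro (u | u) (v | v) - <;> rfl

theorem exists_compat_connect_left (h : Separates m₀ c₀) (hg : m ≤ Setoid.ker g) :
    ∃ f, Compat (connect m₀ c₀ c m) f g := by
  obtain ⟨f, hf, hfc⟩ := h.exists_extension fun i => g (c i)
  exact ⟨f, compat_connect.2 ⟨hf, hg, hfc⟩⟩

theorem le_of_connect_eq (h₀ : Separates m₀ c₀) (h : connect m₀ c₀ c m = connect m₀ c₀ c' m') :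
    m ≤ m' := setoid_le_of_forall_le_ker fun g hg => by
  obtain ⟨f, hfg⟩ := exists_compat_connect_left h₀ hg
  exact (compat_connect.1 (h ▸ hfg)).2.1

theorem rel_of_connect_eq (h₀ : Separates m₀ c₀) (h : connect m₀ c₀ c m = connect m₀ c₀ c' m)
    (i : ι) : m (c i) (c' i) := by
  obtain ⟨f, hf⟩ := exists_compat_connect_left h₀ (le_ker_rel m (c i))
  have hc : f (c₀ i) = m (c i) (c i) := (compat_connect.1 hf).2.2 i
  have hc' : f (c₀ i) = m (c i) (c' i) := (compat_connect.1 (h ▸ hf)).2.2 i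
  exact (hc.symm.trans hc').mp (m.refl' _)

theorem connect_mul_merge (m₀ : Setoid X) (c₀ c : ι → X) (m : Setoid X) :
    connect m₀ c₀ c ⊥ * (merge m : PartitionMonoid X) = connect m₀ c₀ c m :=
  ext_compat fun f g => by
    simp only [compat_mul, compat_merge, compat_connect]
    constructor
    · rintro ⟨_, ⟨hf, -, hc⟩, rfl, hg⟩
      exact ⟨hf, hg, hc⟩
    · rintro ⟨hf, hg, hc⟩
      exact ⟨g, ⟨hf, bot_le, hc⟩, rfl, hg⟩

theorem merge_mul_restrict (m : Setoid X) (c : ι → X) :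
    (merge m * restrict (Set.range c) : PartitionMonoid X) = connect m c c ⊥ :=
  ext_compat fun f g => by
    simp only [compat_mul, compat_merge, compat_restrict, compat_connect, Set.forall_mem_range]
    constructor
    · rintro ⟨_, ⟨rfl, hf⟩, hfg⟩
      exact ⟨hf, bot_le, hfg⟩
    · rintro ⟨hf, -, hfg⟩
      exact ⟨f, ⟨rfl, hf⟩, hfg⟩

theorem connect_mul_merge_link_mul_restrict (h : Separates m c') (hle : link c c' ≤ m) :
    connect m₀ c₀ c ⊥ * (merge (link c c') : PartitionMonoid X) * restrict (Set.range c') =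
      connect m₀ c₀ c' ⊥ :=
  ext_compat fun f g => by
    simp only [compat_mul, compat_restrict, compat_merge, compat_connect, Set.forall_mem_range]
    constructor
    · rintro ⟨_, ⟨k, ⟨hf, -, hfk⟩, rfl, hk⟩, hkg⟩
      exact ⟨hf, bot_le, fun i => (hfk i).trans ((link_le.1 hk i).trans (hkg i))⟩
    · rintro ⟨hf, -, hfg⟩
      obtain ⟨k, hk, hkg⟩ := h.exists_extension fun i => g (c' i)
      have hfk (i : ι) : f (c₀ i) = k (c i) :=
        (hfg i).trans ((hkg i).symm.trans (hk (link_le.1 hle i)).symm)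
      exact ⟨k, ⟨k, ⟨hf, bot_le, hfk⟩, rfl, hle.trans hk⟩, hkg⟩

theorem connect_perm_mul_connect_perm (h₀ : Separates m₀ c₀) (σ τ : Equiv.Perm ι) :
    connect m₀ c₀ (c₀ ∘ σ) m₀ * connect m₀ c₀ (c₀ ∘ τ) m₀ =
      connect m₀ c₀ (c₀ ∘ (τ * σ : Equiv.Perm ι)) m₀ :=
  ext_compat fun f g => by
    simp only [compat_mul, compat_connect, Function.comp_apply, Equiv.Perm.coe_mul]
    constructor
    · rintro ⟨k, ⟨hf, -, hfk⟩, -, hg, hkg⟩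
      exact ⟨hf, hg, fun i => (hfk i).trans (hkg (σ i))⟩
    · rintro ⟨hf, hg, hfg⟩
      obtain ⟨k, hk, hkg⟩ := h₀.exists_extension fun i => g (c₀ (τ i))
      exact ⟨k, ⟨hf, hk, fun i => (hfg i).trans (hkg (σ i)).symm⟩, hk, hg, hkg⟩

theorem greenR_connect_perm_proj (h₀ : Separates m₀ c₀) (σ : Equiv.Perm ι) :
    GreenR (connect m₀ c₀ (c₀ ∘ σ) m₀) (proj m₀ c₀) := by
  have hproj : (proj m₀ c₀ : PartitionMonoid X) =
      connect m₀ c₀ (c₀ ∘ (1 : Equiv.Perm ι)) m₀ := rfl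
  refine ⟨.inr ⟨connect m₀ c₀ (c₀ ∘ σ) m₀, ?_⟩,
    .inr ⟨connect m₀ c₀ (c₀ ∘ (σ⁻¹ : Equiv.Perm ι)) m₀, ?_⟩⟩
  · rw [hproj, connect_perm_mul_connect_perm h₀, mul_one]
  · rw [hproj, connect_perm_mul_connect_perm h₀, inv_mul_cancel]

theorem separates_of_proj_greenRLe_connect (h₀ : Separates m₀ c₀)
    (h : GreenRLe (proj m₀ c₀ : PartitionMonoid X) (connect m₀ c₀ c m)) : Separates m c := by
  intro i j hij
  obtain ⟨f, hf, hfi⟩ := h₀.exists_extension fun k => k = i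
  obtain ⟨g, hg⟩ := exists_compat_of_greenRLe h (compat_proj.2 ⟨hf, hf, fun _ => rfl⟩)
  obtain ⟨-, hmg, hfg⟩ := compat_connect.1 hg
  have hff : f (c₀ i) = f (c₀ j) := (hfg i).trans ((hmg hij).trans (hfg j).symm)
  rw [hfi, hfi] at hff
  exact (hff.mp rfl).symm

theorem exists_mem_rel_of_proj_greenRLe (h₀ : Separates m₀ c₀)
    (h : GreenRLe (proj m₀ c₀ : PartitionMonoid X) (connect m₀ c₀ c m * restrict Y)) (i : ι) :
    ∃ y ∈ Y, m (c i) y := by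
  by_contra! hY
  obtain ⟨f, hf⟩ := exists_compat_connect_left h₀ (le_ker_rel m (c i))
  have hbot : Compat (connect m₀ c₀ c m * restrict Y : PartitionMonoid X) f ⊥ :=
    (compat_mul _ _ _ _).2 ⟨_, hf, compat_restrict.2 fun y hy => eq_false (hY y hy)⟩
  have hfalse : f (c₀ i) = False := (compat_proj.1 (compat_bot_of_greenRLe h hbot)).2.2 i
  have htrue : f (c₀ i) = m (c i) (c i) := (compat_connect.1 hf).2.2 i
  exact (htrue.symm.trans hfalse).mp (m.refl' _)

theorem eq_of_connect_greenL_proj (h₀ : Separates m₀ c₀)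
    (h : GreenL (connect m₀ c₀ c m) (proj m₀ c₀)) : m = m₀ := by
  refine le_antisymm (setoid_le_of_forall_le_ker fun g hg => ?_)
    (setoid_le_of_forall_le_ker fun g hg => ?_)
  · obtain ⟨f, hf⟩ := exists_compat_of_greenLLe h.2 (compat_proj.2 ⟨hg, hg, fun _ => rfl⟩)
    exact (compat_connect.1 hf).2.1
  · obtain ⟨f, hf⟩ := exists_compat_connect_left h₀ hg
    obtain ⟨k, hk⟩ := exists_compat_of_greenLLe h.1 hf
    exact (compat_proj.1 hk).2.1

theorem exists_rel_of_connect_greenLLe_proj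
    (h : GreenLLe (connect m₀ c₀ c m₀) (proj m₀ c₀)) (i : ι) : ∃ j, m₀ (c i) (c₀ j) := by
  by_contra! hno
  have hbot : Compat (proj m₀ c₀ : PartitionMonoid X) ⊥ (m₀ (c i)) :=
    compat_proj.2 ⟨fun _ _ _ => rfl, le_ker_rel m₀ (c i), fun j => (eq_false (hno j)).symm⟩
  have htrue : False = m₀ (c i) (c i) := (compat_connect.1 (compat_bot_of_greenLLe h hbot)).2.2 i
  exact htrue.mpr (m₀.refl' _)

end PartitionMonoid

/-! ### Relations between the generators for `merge` and `restrict` -/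

namespace PartitionMonoid

open PG

variable {X ι : Type*} {m m' : Setoid X} {c : ι → X} {Y Y' : Set X}

theorem x_merge_mul_x_merge (m m' : Setoid X) :
    x (merge m) * x (merge m') = x (merge (m ⊔ m')) :=
  x_mul_x <| ext_compat fun f g => by
    simp only [compat_mul, compat_merge, sup_le_iff]
    constructor
    · rintro ⟨_, ⟨rfl, hm⟩, rfl, hm'⟩
      exact ⟨rfl, hm, hm'⟩
    · rintro ⟨rfl, hm, hm'⟩
      exact ⟨f, ⟨rfl, hm⟩, rfl, hm'⟩

theorem x_merge_mul_x_merge_of_le (h : m ≤ m') :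
    x (merge m) * x (merge m') = x (merge m') := by
  rw [x_merge_mul_x_merge, sup_eq_right.2 h]

theorem x_restrict_mul_x_restrict (h : Y ⊆ Y') :
    x (restrict Y) * x (restrict Y') = x (restrict Y) :=
  x_mul_x <| ext_compat fun f g => by
    simp only [compat_mul, compat_restrict]
    exact ⟨fun ⟨_, hfk, hkg⟩ y hy => (hfk y hy).trans (hkg y (h hy)),
      fun hfg => ⟨g, hfg, fun _ _ => rfl⟩⟩

theorem x_merge_mul_x_restrict_mul_x_merge (m : Setoid X) (c : ι → X) :
    x (merge m) * x (restrict (Set.range c)) * x (merge m) = x (proj m c) :=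
  x_mul_x_mul_x <| ext_compat fun f g => by
    simp only [compat_mul, compat_restrict, compat_merge, compat_proj, Set.forall_mem_range]
    constructor
    · rintro ⟨_, ⟨_, ⟨rfl, hf⟩, hc⟩, rfl, hg⟩
      exact ⟨hf, hg, hc⟩
    · rintro ⟨hf, hg, hc⟩
      exact ⟨g, ⟨f, ⟨rfl, hf⟩, hc⟩, rfl, hg⟩

theorem exists_x_eq_x_merge_mul_x_restrict_mul_x_merge (p : Projections (PartitionMonoid X)) :
    ∃ m Y, x p = x (merge m) * x (restrict Y) * x (merge m) := by
  let Y : Set X := {z | ∃ y, p.1.rel (.inl z) (.inr y)}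
  have hp : leftProj (p : PartitionMonoid X) = proj (ker (p : PartitionMonoid X)) ((↑) : Y → X) :=
    leftProj_eq_proj (fun i => i.2) fun h => ⟨⟨_, _, h⟩, (ker _).refl' _⟩
  refine ⟨ker (p : PartitionMonoid X), Set.range ((↑) : Y → X), ?_⟩
  rw [x_merge_mul_x_restrict_mul_x_merge, ← hp, leftProj_coe]

theorem x_restrict_mul_x_merge_mul_x_restrict (h : Separates m c) :
    x (restrict (Set.range c)) * x (merge m) * x (restrict (Set.range c)) =
      x (restrict (Set.range c)) :=
  x_mul_x_mul_x <| ext_compat fun f g => by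
    simp only [compat_mul, compat_restrict, compat_merge, Set.forall_mem_range]
    constructor
    · rintro ⟨_, ⟨k, hfk, rfl, -⟩, hkg⟩ i
      rw [hfk, hkg]
    · intro hfg
      obtain ⟨k, hk, hkc⟩ := h.exists_extension fun i => f (c i)
      exact ⟨k, ⟨k, fun i => (hkc i).symm, rfl, hk⟩, fun i => (hkc i).trans (hfg i)⟩

theorem x_merge_link_mul_x_restrict_mul_x_merge_link (c c' : ι → X) :
    x (merge (link c c')) * x (restrict (Set.range c')) * x (merge (link c c')) =
      x (restrict (Set.range c ∪ Set.range c')) * x (merge (link c c')) :=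
  x_mul_x_mul_x_eq <| ext_compat fun f g => by
    simp only [compat_mul, compat_restrict, compat_merge, Set.forall_mem_range, link_le,
      Setoid.ker_def]
    constructor
    · rintro ⟨_, ⟨_, ⟨rfl, hf⟩, hfg⟩, rfl, hg⟩
      refine ⟨_, ?_, rfl, hg⟩
      rintro _ (⟨i, rfl⟩ | ⟨i, rfl⟩)
      · rw [hf, hfg, hg]
      · exact hfg i
    · rintro ⟨_, hfg, rfl, hg⟩
      refine ⟨_, ⟨f, ⟨rfl, fun i => ?_⟩, fun i => hfg _ (.inr ⟨i, rfl⟩)⟩, rfl, hg⟩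
      rw [hfg _ (.inl ⟨i, rfl⟩), hfg _ (.inr ⟨i, rfl⟩), hg]

theorem x_restrict_mul_x_merge_mul_x_restrict_eq_mul_x_merge_isolate (m : Setoid X) (Y : Set X) :
    x (restrict Y) * x (merge m) * x (restrict Y) = x (restrict Y) * x (merge (isolate m Y)) :=
  x_mul_x_mul_x_eq <| ext_compat fun f g => by
    simp only [compat_mul, compat_restrict, compat_merge]
    constructor
    · rintro ⟨_, ⟨k, hfk, rfl, hk⟩, hkg⟩
      refine ⟨g, fun y hy => (hfk y hy).trans (hkg y hy), rfl, ?_⟩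
      rintro y z (rfl | ⟨hy, hz, hyz⟩)
      · rfl
      · exact (hkg y hy).symm.trans ((hk hyz).trans (hkg z hz))
    · rintro ⟨g, hfg, rfl, hg⟩
      let k : X → Prop := fun z => ∃ y ∈ Y, m y z ∧ g y
      have hk : m ≤ Setoid.ker k := fun z z' hzz' => propext <| exists_congr fun y =>
        and_congr_right fun _ => and_congr_left fun _ =>
          ⟨fun h => m.trans' h hzz', fun h => m.trans' h (m.symm' hzz')⟩
      have hkg {z : X} (hz : z ∈ Y) : k z = g z := propext
        ⟨fun ⟨y, hy, hyz, hgy⟩ => (hg (.inr ⟨hy, hz, hyz⟩ : isolate m Y y z)).mp hgy,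
          fun hgz => ⟨z, hz, m.refl' z, hgz⟩⟩
      exact ⟨k, ⟨k, fun z hz => (hfg z hz).trans (hkg hz).symm, rfl, hk⟩, fun z hz => hkg hz⟩

end PartitionMonoid

/-! ### The local system of lifts to the free projection-generated semigroup -/

section Coherent

variable {X ι : Type*} {i j : ι} {c c' c₁ c₂ c₃ c₄ : ι ↪ X}

/-- Equal points of the two configurations have the same label. -/
def Coherent (c c' : ι ↪ X) : Prop := ∀ ⦃i j⦄, c i = c' j → i = j

theorem Coherent.refl (c : ι ↪ X) : Coherent c c := fun _ _ h => c.injective h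

theorem Coherent.symm (h : Coherent c c') : Coherent c' c := fun _ _ hij => (h hij.symm).symm

theorem AgreeOff.coherent (h : AgreeOff i c c') : Coherent c c' := by
  intro j k hjk
  by_cases hk : k = i
  · by_cases hj : j = i
    · rw [hj, hk]
    · exact c'.injective ((h j hj).symm.trans hjk)
  · exact c.injective (hjk.trans (h k hk).symm)

theorem Coherent.of_agreeOff (hij : i ≠ j) (h₂ : Coherent c₁ c₂) (h₄ : Coherent c₁ c₄)
    (h₂₃ : AgreeOff j c₂ c₃) (h₄₃ : AgreeOff i c₄ c₃) : Coherent c₁ c₃ := by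
  intro k l hkl
  by_cases hl : l = i
  · exact h₂ (hkl.trans (h₂₃ l (hl ▸ hij)).symm)
  · exact h₄ (hkl.trans (h₄₃ l hl).symm)

theorem exists_separates (h₁₂ : Coherent c₁ c₂) (h₁₃ : Coherent c₁ c₃) (h₂₃ : Coherent c₂ c₃) :
    ∃ m, link c₁ c₂ ≤ m ∧ link c₁ c₃ ≤ m ∧ link c₂ c₃ ≤ m ∧ Separates m c₃ := by
  let labels (y : X) : Set ι := {i | c₁ i = y ∨ c₂ i = y ∨ c₃ i = y}
  have hlabels {c : ι ↪ X} (hc : Coherent c₁ c ∧ Coherent c₂ c ∧ Coherent c₃ c)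
      (hmem : ∀ i, i ∈ labels (c i)) (i : ι) : labels (c i) = {i} :=
    Set.eq_singleton_iff_unique_mem.2 ⟨hmem i, fun _ hj =>
      hj.elim (hc.1 ·) (Or.elim · (hc.2.1 ·) (hc.2.2 ·))⟩
  have h₁ := hlabels ⟨.refl c₁, h₁₂.symm, h₁₃.symm⟩ fun _ => .inl rfl
  have h₂ := hlabels ⟨h₁₂, .refl c₂, h₂₃.symm⟩ fun _ => .inr (.inl rfl)
  have h₃ := hlabels ⟨h₁₃, h₂₃, .refl c₃⟩ fun _ => .inr (.inr rfl)
  refine ⟨Setoid.ker labels, link_le.2 fun i => (h₁ i).trans (h₂ i).symm,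
    link_le.2 fun i => (h₁ i).trans (h₃ i).symm, link_le.2 fun i => (h₂ i).trans (h₃ i).symm,
    fun i j hij => ?_⟩
  exact Set.singleton_injective ((h₃ i).symm.trans (Eq.trans hij (h₃ j)))

end Coherent

namespace PartitionMonoid

open PG

variable {X : Type u} {ι : Type*} {m₀ m : Setoid X} {i : ι} {c₀ c c' c₁ c₂ c₃ : ι ↪ X}
  {w w' : PG (PartitionMonoid X)}

/-- Moves the transversals of `w` from the points `c i` to the points `c' i`. -/
def transport (c c' : ι ↪ X) (w : PG (PartitionMonoid X)) : PG (PartitionMonoid X) :=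
  w * x (merge (link c c')) * x (restrict (Set.range c'))

theorem transport_mul_x_restrict (c c' : ι ↪ X) (w : PG (PartitionMonoid X)) :
    transport c c' w * x (restrict (Set.range c')) = transport c c' w := by
  rw [transport, mul_assoc, x_mul_self]

theorem transport_mul_x_merge (hw : w * x (restrict (Set.range c)) = w) (h : link c c' ≤ m) :
    transport c c' w * x (merge m) = w * x (merge m) := by
  calc transport c c' w * x (merge m)
      = w * (x (merge (link c c')) * x (restrict (Set.range c')) * x (merge (link c c'))) *
          x (merge m) := by
        rw [transport]
        conv_lhs => rw [← x_merge_mul_x_merge_of_le h]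
        simp only [mul_assoc]
    _ = w * (x (restrict (Set.range c)) * x (restrict (Set.range c ∪ Set.range c'))) *
          (x (merge (link c c')) * x (merge m)) := by
        rw [x_merge_link_mul_x_restrict_mul_x_merge_link]
        conv_lhs => rw [← hw]
        simp only [mul_assoc]
    _ = w * x (merge m) := by
        rw [x_restrict_mul_x_restrict Set.subset_union_left, hw, x_merge_mul_x_merge_of_le h]

theorem mul_x_merge_mul_x_restrict (hw : w * x (restrict (Set.range c)) = w)
    (h : Separates m c) : w * x (merge m) * x (restrict (Set.range c)) = w := by
  calc w * x (merge m) * x (restrict (Set.range c))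
      = w * (x (restrict (Set.range c)) * x (merge m) * x (restrict (Set.range c))) := by
        conv_lhs => rw [← hw]
        simp only [mul_assoc]
    _ = w := by rw [x_restrict_mul_x_merge_mul_x_restrict h, hw]

theorem eq_of_mul_x_merge_eq (hw : w * x (restrict (Set.range c)) = w)
    (hw' : w' * x (restrict (Set.range c)) = w') (h : Separates m c)
    (heq : w * x (merge m) = w' * x (merge m)) : w = w' := by
  rw [← mul_x_merge_mul_x_restrict hw h, heq, mul_x_merge_mul_x_restrict hw' h]

theorem transport_self (hw : w * x (restrict (Set.range c)) = w) : transport c c w = w := by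
  obtain ⟨m, hle, -, -, hsep⟩ := exists_separates (.refl c) (.refl c) (.refl c)
  exact eq_of_mul_x_merge_eq (transport_mul_x_restrict c c w) hw hsep
    (transport_mul_x_merge hw hle)

theorem transport_transport (hw : w * x (restrict (Set.range c₁)) = w) (h₁₂ : Coherent c₁ c₂)
    (h₁₃ : Coherent c₁ c₃) (h₂₃ : Coherent c₂ c₃) :
    transport c₂ c₃ (transport c₁ c₂ w) = transport c₁ c₃ w := by
  obtain ⟨m, hle₁₂, hle₁₃, hle₂₃, hsep⟩ := exists_separates h₁₂ h₁₃ h₂₃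
  refine eq_of_mul_x_merge_eq (transport_mul_x_restrict _ _ _) (transport_mul_x_restrict _ _ _)
    hsep ?_
  rw [transport_mul_x_merge (transport_mul_x_restrict _ _ _) hle₂₃,
    transport_mul_x_merge hw hle₁₂, transport_mul_x_merge hw hle₁₃]

theorem toSemigroup_transport (h : Coherent c c')
    (hw : toSemigroup (PartitionMonoid X) w = connect m₀ c₀ c ⊥) :
    toSemigroup (PartitionMonoid X) (transport c c' w) = connect m₀ c₀ c' ⊥ := by
  obtain ⟨m, hle, -, -, hsep⟩ := exists_separates h h (.refl c')
  rw [transport, map_mul, map_mul, hw]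
  exact connect_mul_merge_link_mul_restrict hsep hle

/-- The local system whose fibre over `c` consists of the elements of `PG` that lie over
`connect m₀ c₀ c ⊥` and have the generator of `restrict (Set.range c)` as a right identity. -/
def liftSystem (m₀ : Setoid X) (c₀ : ι ↪ X) : LocalSystem ι X where
  fib c := {w : PG (PartitionMonoid X) // w * x (restrict (Set.range c)) = w ∧
    toSemigroup (PartitionMonoid X) w = connect m₀ c₀ c ⊥}
  tr {_ c c'} h w := ⟨transport c c' w, transport_mul_x_restrict c c' w,
    toSemigroup_transport h.coherent w.2.2⟩
  tr_refl _ _ w := Subtype.ext (transport_self w.2.1)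
  tr_tr h h' w := Subtype.ext <|
    transport_transport w.2.1 h.coherent (h.trans h').coherent h'.coherent
  tr_square hij h₁₂ h₂₃ h₁₄ h₄₃ w := Subtype.ext <| by
    -- The diagonal is coherent, and it cuts the square into two triangles.
    have h₁₃ := h₁₂.coherent.of_agreeOff hij h₁₄.coherent h₂₃ h₄₃
    exact (transport_transport w.2.1 h₁₂.coherent h₁₃ h₂₃.coherent).trans
      (transport_transport w.2.1 h₁₄.coherent h₁₃ h₄₃.coherent).symm

/-- A flat choice of lifts to `PG` of the elements `connect m₀ c₀ c ⊥`, based at the projection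
`proj m₀ c₀`. -/
structure FlatLift (m₀ : Setoid X) (c₀ : ι ↪ X) where
  lift : (ι ↪ X) → PG (PartitionMonoid X)
  lift_base : lift c₀ = x (merge m₀) * x (restrict (Set.range c₀))
  lift_mul_x_restrict (c : ι ↪ X) : lift c * x (restrict (Set.range c)) = lift c
  toSemigroup_lift (c : ι ↪ X) :
    toSemigroup (PartitionMonoid X) (lift c) = connect m₀ c₀ c ⊥
  transport_lift {i : ι} {c c' : ι ↪ X} : AgreeOff i c c' → transport c c' (lift c) = lift c'

theorem nonempty_flatLift {r : ℕ} (hX : (r : ℕ∞) + 2 ≤ ENat.card X) (m₀ : Setoid X)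
    (c₀ : Fin r ↪ X) : Nonempty (FlatLift m₀ c₀) := by
  let w₀ : (liftSystem m₀ c₀).fib c₀ := ⟨x (merge m₀) * x (restrict (Set.range c₀)),
    by rw [mul_assoc, x_mul_self], merge_mul_restrict m₀ c₀⟩
  obtain ⟨s, hs₀, hs⟩ := (liftSystem m₀ c₀).exists_flat_section hX c₀ w₀
  exact ⟨{  lift := fun c => (s c).1
            lift_base := congrArg Subtype.val hs₀
            lift_mul_x_restrict := fun c => (s c).2.1
            toSemigroup_lift := fun c => (s c).2.2
            transport_lift := fun h => congrArg Subtype.val (hs h) }⟩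

namespace FlatLift

theorem lift_base_mul_x_merge (L : FlatLift m₀ c₀) :
    L.lift c₀ * x (merge m₀) = x (proj m₀ c₀) := by
  rw [L.lift_base, x_merge_mul_x_restrict_mul_x_merge]

theorem toSemigroup_lift_mul_x_merge (L : FlatLift m₀ c₀) (c : ι ↪ X) (m : Setoid X) :
    toSemigroup (PartitionMonoid X) (L.lift c * x (merge m)) = connect m₀ c₀ c m := by
  rw [map_mul, L.toSemigroup_lift, toSemigroup_x, connect_mul_merge]

theorem lift_mul_x_merge_eq_of_agreeOff (L : FlatLift m₀ c₀) (hc : AgreeOff i c c')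
    (h : ∀ j, m (c j) (c' j)) : L.lift c * x (merge m) = L.lift c' * x (merge m) := by
  rw [← L.transport_lift hc, transport_mul_x_merge (L.lift_mul_x_restrict c) (link_le.2 h)]

theorem lift_mul_x_merge_eq [Finite ι] (L : FlatLift m₀ c₀) (hsep : Separates m c)
    (h : ∀ i, m (c i) (c' i)) : L.lift c * x (merge m) = L.lift c' * x (merge m) := by
  classical
  have := Fintype.ofFinite ι
  suffices H : ∀ (A : Finset ι) (c : ι ↪ X), Separates m c → (∀ i, m (c i) (c' i)) →
      (∀ i ∉ A, c i = c' i) → L.lift c * x (merge m) = L.lift c' * x (merge m) from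
    H Finset.univ c hsep h (by simp)
  intro A
  induction A using Finset.induction_on with
  | empty =>
    intro c _ _ hcc'
    rw [DFunLike.ext c c' fun i => hcc' i (Finset.notMem_empty i)]
  | insert a A _ ih =>
    intro c hsep h hcc'
    have hupd (i : ι) : m (c i) (Function.update c a (c' a) i) := by
      obtain rfl | hi := eq_or_ne i a
      · simpa using h i
      · simp [hi]
    let d : ι ↪ X := ⟨Function.update c a (c' a), (hsep.of_rel hupd).injective⟩
    have hcd : AgreeOff a c d := fun j hj => (Function.update_of_ne hj _ _).symm
    rw [L.lift_mul_x_merge_eq_of_agreeOff hcd hupd]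
    refine ih d (hsep.of_rel hupd) (fun i => m.trans' (m.symm' (hupd i)) (h i)) fun i hi => ?_
    obtain rfl | hia := eq_or_ne i a
    · exact Function.update_self i (c' i) c
    · exact (hcd i hia).symm.trans (hcc' i (by simp [hi, hia]))

end FlatLift

end PartitionMonoid

/-! ### Normal forms, and injectivity of the canonical map on small ranks -/

namespace PartitionMonoid

open PG

variable {X ι : Type*} {m₀ m : Setoid X} {c₀ : ι ↪ X} {v w w' : PG (PartitionMonoid X)}

namespace FlatLift

/-- The normal form `L.lift c * x (merge m)` of the elements of `PG` that are `R`-above the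
projection `proj m₀ c₀`. -/
def HasNormalForm (L : FlatLift m₀ c₀) (w : PG (PartitionMonoid X)) : Prop :=
  ∃ (c : ι ↪ X) (m : Setoid X), Separates m c ∧ w = L.lift c * x (merge m)

variable {L : FlatLift m₀ c₀}

theorem HasNormalForm.mul_x_merge (h₀ : Separates m₀ c₀) (hw : L.HasNormalForm w)
    (h : GreenRLe (proj m₀ c₀ : PartitionMonoid X)
      (toSemigroup (PartitionMonoid X) (w * x (merge m)))) :
    L.HasNormalForm (w * x (merge m)) := by
  obtain ⟨c, m', -, rfl⟩ := hw
  rw [mul_assoc, x_merge_mul_x_merge] at h ⊢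
  rw [L.toSemigroup_lift_mul_x_merge] at h
  exact ⟨c, m' ⊔ m, separates_of_proj_greenRLe_connect h₀ h, rfl⟩

theorem HasNormalForm.mul_x_restrict [Finite ι] {Y : Set X} (h₀ : Separates m₀ c₀)
    (hw : L.HasNormalForm w)
    (h : GreenRLe (proj m₀ c₀ : PartitionMonoid X)
      (toSemigroup (PartitionMonoid X) (w * x (restrict Y)))) :
    L.HasNormalForm (w * x (restrict Y)) := by
  obtain ⟨c, m, hm, rfl⟩ := hw
  rw [map_mul, L.toSemigroup_lift_mul_x_merge, toSemigroup_x] at h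
  choose y hyY hy using exists_mem_rel_of_proj_greenRLe h₀ h
  have hym : Separates m y := hm.of_rel hy
  let c' : ι ↪ X := ⟨y, hym.injective⟩
  have hrange : Set.range c' ⊆ Y := Set.range_subset_iff.2 hyY
  have hlift : L.lift c' * x (restrict Y) = L.lift c' := by
    rw [← L.lift_mul_x_restrict c', mul_assoc, x_restrict_mul_x_restrict hrange]
  refine ⟨c', isolate m Y, hym.isolate Y, ?_⟩
  calc L.lift c * x (merge m) * x (restrict Y)
      = L.lift c' * x (restrict Y) * x (merge m) * x (restrict Y) := by
        rw [L.lift_mul_x_merge_eq hm hy (c' := c'), hlift]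
    _ = L.lift c' * (x (restrict Y) * x (merge m) * x (restrict Y)) := by simp only [mul_assoc]
    _ = L.lift c' * x (merge (isolate m Y)) := by
        rw [x_restrict_mul_x_merge_mul_x_restrict_eq_mul_x_merge_isolate, ← mul_assoc, hlift]

theorem HasNormalForm.mul [Finite ι] (h₀ : Separates m₀ c₀) (hw : L.HasNormalForm w)
    (h : GreenRLe (proj m₀ c₀ : PartitionMonoid X) (toSemigroup (PartitionMonoid X) (w * v))) :
    L.HasNormalForm (w * v) := by
  have hprefix {y z : PG (PartitionMonoid X)}
      (h : GreenRLe (proj m₀ c₀ : PartitionMonoid X) (toSemigroup (PartitionMonoid X) (y * z))) :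
      GreenRLe (proj m₀ c₀ : PartitionMonoid X) (toSemigroup (PartitionMonoid X) y) :=
    h.trans ((greenRLe_mul_right y z).map _)
  have hgen {w : PG (PartitionMonoid X)} {p : Projections (PartitionMonoid X)}
      (hw : L.HasNormalForm w)
      (h : GreenRLe (proj m₀ c₀ : PartitionMonoid X)
        (toSemigroup (PartitionMonoid X) (w * x p))) : L.HasNormalForm (w * x p) := by
    obtain ⟨m, Y, hp⟩ := exists_x_eq_x_merge_mul_x_restrict_mul_x_merge p
    rw [hp, ← mul_assoc, ← mul_assoc] at h ⊢
    have hm := hw.mul_x_merge h₀ (hprefix (hprefix h))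
    exact (hm.mul_x_restrict h₀ (hprefix h)).mul_x_merge h₀ h
  induction v using PG.induction_on generalizing w with
  | x p => exact hgen hw h
  | x_mul p v hv =>
    rw [← mul_assoc] at h ⊢
    exact hv (hgen hw (hprefix h)) h

theorem hasNormalForm_of_greenR [Finite ι] (L : FlatLift m₀ c₀) (h₀ : Separates m₀ c₀)
    (h : GreenR (toSemigroup (PartitionMonoid X) w) (proj m₀ c₀)) : L.HasNormalForm w := by
  have hw : x (proj m₀ c₀) * w = w := x_mul_of_greenRLe h.1
  have hbase : L.HasNormalForm (x (proj m₀ c₀)) := ⟨c₀, m₀, h₀, L.lift_base_mul_x_merge.symm⟩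
  rw [← hw]
  exact hbase.mul h₀ (hw.symm ▸ h.2)

theorem eq_of_toSemigroup_eq [Finite ι] (L : FlatLift m₀ c₀) (h₀ : Separates m₀ c₀)
    (h : GreenR (toSemigroup (PartitionMonoid X) w) (proj m₀ c₀))
    (heq : toSemigroup (PartitionMonoid X) w = toSemigroup (PartitionMonoid X) w') : w = w' := by
  obtain ⟨c, m, hm, rfl⟩ := L.hasNormalForm_of_greenR h₀ h
  obtain ⟨c', m', -, rfl⟩ := L.hasNormalForm_of_greenR h₀ (heq ▸ h)
  simp only [L.toSemigroup_lift_mul_x_merge] at heq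
  obtain rfl : m = m' := le_antisymm (le_of_connect_eq h₀ heq) (le_of_connect_eq h₀ heq.symm)
  exact L.lift_mul_x_merge_eq hm (rel_of_connect_eq h₀ heq)

end FlatLift

end PartitionMonoid

/-! ### The maximal subgroups -/

namespace PartitionMonoid

open PG

variable {X : Type*} {ι : Type*} {m₀ : Setoid X} {c₀ : ι ↪ X}

namespace FlatLift

/-- The lift to `PG` of the group `H`-class of `proj m₀ c₀`. The inverse makes up for the reversed
order of composition in `connect_perm_mul_connect_perm`. -/
def ofPerm (L : FlatLift m₀ c₀) (σ : Equiv.Perm ι) : PG (PartitionMonoid X) :=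
  L.lift (σ⁻¹.toEmbedding.trans c₀) * x (merge m₀)

theorem toSemigroup_ofPerm (L : FlatLift m₀ c₀) (σ : Equiv.Perm ι) :
    toSemigroup (PartitionMonoid X) (L.ofPerm σ) =
      connect m₀ c₀ (c₀ ∘ (σ⁻¹ : Equiv.Perm ι)) m₀ :=
  L.toSemigroup_lift_mul_x_merge _ _

theorem ofPerm_one (L : FlatLift m₀ c₀) : L.ofPerm 1 = x (proj m₀ c₀) :=
  L.lift_base_mul_x_merge

theorem ofPerm_mul [Finite ι] (L : FlatLift m₀ c₀) (h₀ : Separates m₀ c₀) (σ τ : Equiv.Perm ι) :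
    L.ofPerm (σ * τ) = L.ofPerm σ * L.ofPerm τ := by
  refine L.eq_of_toSemigroup_eq h₀ ?_ ?_
  · rw [L.toSemigroup_ofPerm]
    exact greenR_connect_perm_proj h₀ _
  · simp only [map_mul, L.toSemigroup_ofPerm, connect_perm_mul_connect_perm h₀, mul_inv_rev]

theorem ofPerm_injective (L : FlatLift m₀ c₀) (h₀ : Separates m₀ c₀) :
    Function.Injective L.ofPerm := by
  intro σ τ h
  have hconnect := congrArg (toSemigroup (PartitionMonoid X)) h
  simp only [L.toSemigroup_ofPerm] at hconnect
  exact inv_injective (Equiv.ext fun i => h₀ (rel_of_connect_eq h₀ hconnect i))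

theorem mem_range_ofPerm [Finite ι] (L : FlatLift m₀ c₀) (h₀ : Separates m₀ c₀)
    {w : PG (PartitionMonoid X)} (hw : GreenH w (x (proj m₀ c₀))) :
    w ∈ Set.range L.ofPerm := by
  obtain ⟨hL, hR⟩ := hw
  let π := toSemigroup (PartitionMonoid X)
  obtain ⟨c, m, hm, rfl⟩ := L.hasNormalForm_of_greenR h₀ ⟨hR.1.map π, hR.2.map π⟩
  have hπ : GreenL (connect m₀ c₀ c m) (proj m₀ c₀) := by
    rw [← L.toSemigroup_lift_mul_x_merge]
    exact ⟨hL.1.map π, hL.2.map π⟩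
  obtain rfl : m = m₀ := eq_of_connect_greenL_proj h₀ hπ
  choose σ hσ using exists_rel_of_connect_greenLLe_proj hπ.1
  have hσ_inj : Function.Injective σ := fun i j hij =>
    hm (m.trans' (hσ i) (m.symm' (hij ▸ hσ j)))
  refine ⟨(Equiv.ofBijective σ (Finite.injective_iff_bijective.1 hσ_inj))⁻¹, ?_⟩
  rw [ofPerm, inv_inv]
  exact (L.lift_mul_x_merge_eq hm hσ).symm

/-- The isomorphism of the symmetric group with the maximal subgroup of `PG` that contains the
generator of `proj m₀ c₀`. -/
noncomputable def permEquiv [Finite ι] (L : FlatLift m₀ c₀) (h₀ : Separates m₀ c₀) :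
    Equiv.Perm ι ≃* maximalSubgroup (x (proj m₀ c₀)) (isIdempotentElem_x _) :=
  mulEquivMaximalSubgroup ⟨L.ofPerm, L.ofPerm_mul h₀⟩ (L.ofPerm_injective h₀) _ L.ofPerm_one
    fun _ => L.mem_range_ofPerm h₀

end FlatLift

/-! ### The rank -/

/-- The set of transversals: the blocks that meet both rows. -/
def transversals (a : PartitionMonoid X) : Set (Set (X ⊕ X)) :=
  {B ∈ a.rel.classes | (∃ x, Sum.inl x ∈ B) ∧ ∃ y, Sum.inr y ∈ B}

/-- The rank in `ℕ∞`; over an infinite `X`, a partition with infinitely many transversals has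
`rank` zero. -/
noncomputable def erank (a : PartitionMonoid X) : ℕ∞ := a.transversals.encard

theorem erank_eq_rank [Finite X] (a : PartitionMonoid X) : a.erank = a.rank :=
  (Set.toFinite a.transversals).cast_ncard_eq.symm

theorem exists_leftProj_eq_proj {r : ℕ} {a : PartitionMonoid X} (ha : a.erank = r) :
    ∃ (m : Setoid X) (c : Fin r ↪ X), Separates m c ∧ leftProj a = proj m c := by
  have hfin : a.transversals.Finite := Set.finite_of_encard_eq_coe ha
  have := hfin.to_subtype
  have hcard : Nat.card a.transversals = r := by
    rw [Nat.card_coe_set_eq, Set.ncard, ← erank, ha, ENat.toNat_natCast]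
  let B : Fin r ≃ a.transversals := (Finite.equivFinOfCardEq hcard).symm
  choose c hc using fun i => (B i).2.2.1
  choose d hd using fun i => (B i).2.2.2
  have hB {i : Fin r} {u : X ⊕ X} (hu : u ∈ (B i : Set (X ⊕ X))) :
      (B i : Set (X ⊕ X)) = {v | a.rel v u} :=
    Setoid.eq_of_mem_classes (B i).2.1 hu (a.rel.mem_classes u) (a.rel.refl' u)
  have hsep : Separates (ker a) c := fun i j hij => by
    have hi : .inl (c i) ∈ (B j : Set (X ⊕ X)) := hB (hc j) ▸ hij
    exact B.injective (Subtype.ext ((hB (hc i)).trans (hB hi).symm))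
  refine ⟨ker a, ⟨c, hsep.injective⟩, hsep, leftProj_eq_proj (fun i => ⟨d i, ?_⟩) ?_⟩
  · exact (hB (hd i) ▸ hc i : Sum.inl (c i) ∈ {v | a.rel v (.inr (d i))})
  · intro x y hxy
    obtain ⟨i, hi⟩ := B.surjective ⟨_, a.rel.mem_classes (.inl x), ⟨x, a.rel.refl' _⟩, y,
      a.rel.symm' hxy⟩
    refine ⟨i, ?_⟩
    have hci := hc i
    rwa [hi] at hci

theorem eq_of_toSemigroup_eq_of_erank {r : ℕ} (hX : (r : ℕ∞) + 2 ≤ ENat.card X)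
    {w w' : PG (PartitionMonoid X)} (hw : (toSemigroup (PartitionMonoid X) w).erank = r)
    (h : toSemigroup (PartitionMonoid X) w = toSemigroup (PartitionMonoid X) w') : w = w' := by
  obtain ⟨m, c, hsep, hproj⟩ := exists_leftProj_eq_proj hw
  obtain ⟨L⟩ := nonempty_flatLift hX m c
  exact L.eq_of_toSemigroup_eq hsep (hproj ▸ greenR_leftProj _) h

theorem nonempty_maximalSubgroup_mulEquiv_perm {r : ℕ} (hX : (r : ℕ∞) + 2 ≤ ENat.card X)
    {f : PG (PartitionMonoid X)} (hf : IsIdempotentElem f)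
    (hr : (toSemigroup (PartitionMonoid X) f).erank = r) :
    Nonempty (maximalSubgroup f hf ≃* Equiv.Perm (Fin r)) := by
  obtain ⟨m, c, hsep, hproj⟩ := exists_leftProj_eq_proj hr
  obtain ⟨L⟩ := nonempty_flatLift hX m c
  have hπ : GreenR (toSemigroup (PartitionMonoid X) f) (proj m c) := hproj ▸ greenR_leftProj _
  have hpf : x (proj m c) * f = f := x_mul_of_greenRLe hπ.1
  have hfp : x (proj m c) = f * x (proj m c) := by
    refine L.eq_of_toSemigroup_eq hsep ⟨.inl rfl, .inl rfl⟩ ?_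
    rw [map_mul, toSemigroup_x, hπ.2.mul_eq (hf.map _)]
  have hR : GreenR f (x (proj m c)) := ⟨.inr ⟨f, hpf.symm⟩, .inr ⟨x (proj m c), hfp⟩⟩
  exact ⟨(hR.maximalSubgroupEquiv hf (isIdempotentElem_x _)).trans (L.permEquiv hsep).symm⟩

end PartitionMonoid

theorem theorem1p1_general {X : Type*} {r : ℕ} (hX : (r : ℕ∞) + 2 ≤ ENat.card X) :
    (∀ p : Projections (PartitionMonoid X), p.1.erank = r →
      Nonempty (maximalSubgroup (PG.x p) (PG.isIdempotentElem_x p) ≃* Equiv.Perm (Fin r))) ∧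
    (∀ e : PartitionMonoid X, IsIdempotentElem e → e.erank = r →
      (∃! f : PG (PartitionMonoid X),
        IsIdempotentElem f ∧ PG.toSemigroup (PartitionMonoid X) f = e) ∧
      ∀ (f : PG (PartitionMonoid X)) (hf : IsIdempotentElem f),
        PG.toSemigroup (PartitionMonoid X) f = e →
          Nonempty (maximalSubgroup f hf ≃* Equiv.Perm (Fin r))) := by
  refine ⟨fun p hp => PartitionMonoid.nonempty_maximalSubgroup_mulEquiv_perm hX _ hp,
    fun e he her => ⟨?_, ?_⟩⟩
  · obtain ⟨f, hf, rfl⟩ := PG.exists_isIdempotentElem_toSemigroup_eq he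
    exact ⟨f, ⟨hf, rfl⟩, fun f' hf' =>
      (PartitionMonoid.eq_of_toSemigroup_eq_of_erank hX her hf'.2.symm).symm⟩
  · rintro f hf rfl
    exact PartitionMonoid.nonempty_maximalSubgroup_mulEquiv_perm hX hf her

theorem theorem1p1 (n r : ℕ) (hr : r + 2 ≤ n) :
    (∀ p : Projections (PartitionMonoid (Fin n)), p.1.rank = r →
      Nonempty (maximalSubgroup (PG.x p) (PG.isIdempotentElem_x p) ≃* Equiv.Perm (Fin r))) ∧
    (∀ e : PartitionMonoid (Fin n), IsIdempotentElem e → e.rank = r →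
      (∃! f : PG (PartitionMonoid (Fin n)),
        IsIdempotentElem f ∧ PG.toSemigroup (PartitionMonoid (Fin n)) f = e) ∧
      ∀ (f : PG (PartitionMonoid (Fin n))) (hf : IsIdempotentElem f),
        PG.toSemigroup (PartitionMonoid (Fin n)) f = e →
          Nonempty (maximalSubgroup f hf ≃* Equiv.Perm (Fin r))) := by
  simpa only [PartitionMonoid.erank_eq_rank, Nat.cast_inj] using
    theorem1p1_general (X := Fin n) (r := r) (by simpa using mod_cast hr)
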